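/- Let $D([0,\infty))$ be the space of functions $x:[0,\infty)\to\mathbb R$ that are right-continuous at every $t\ge 0$ and have finite left limits at every $t>0$. For $T>0$ let $D([0,T])$ be the space of functions $x:[0,T]\to\mathbb R$ that are right-continuous at every $t\in[0,T)$ and have finite left limits at every $t\in(0,T]$; for $x\in D([0,\infty))$ let $x^T\in D([0,T])$ be the restriction of $x$ to $[0,T]$. For $v:[0,T]\to\mathbb R$ put $$\|v\|(T)=\sup\Big\{|v(0)|+\sum_{i=1}^m|v(t_i)-v(t_{i-1})| : 0=t_0<t_1<\dots<t_m=T,\ m\in\mathbb N\Big\},$$ and let $\mathbb V([0,T])=\{v\in D([0,T]):\|v\|(T)<\infty\}$. For $v\in\mathbb V([0,T])$, $dv$ is the signed Borel measure on $[0,T]$ with $dv([0,t])=v(t)$ for all $t\in[0,T]$ (so it has an atom of mass $v(0)$ at $0$). *$S$-convergence.* For $x_n\in D([0,T])$, $n=0,1,2,\dots$, write $x_n\to_S x_0$ if for every $\varepsilon>0$ there are $v_{n,\varepsilon}\in\mathbb V([0,T])$, $n=0,1,2,\dots$, such that $\sup_{t\in[0,T]}|x_n(t)-v_{n,\varepsilon}(t)|\le\varepsilon$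 for all $n\ge 0$ and $\int_{[0,T]}f\,dv_{n,\varepsilon}\to\int_{[0,T]}f\,dv_{0,\varepsilon}$ as $n\to\infty$ for every continuous $f:[0,T]\to\mathbb R$. *Convergence $\stackrel{*}{\to}$.* Let $\mathbb A([0,T])$ be the set of continuous $A\in\mathbb V([0,T])$ with $A(0)=0$. For $A_n\in\mathbb A([0,T])$, $n=0,1,2,\dots$, write $A_n\to_\tau A_0$ if $\sup_{t\in[0,T]}|A_n(t)-A_0(t)|\to0$ and $\sup_n\|A_n\|(T)<\infty$. For $x_n\in D([0,\infty))$, $n=0,1,2,\dots$, write $x_n\stackrel{*}{\to}x_0$ in $D([0,\infty))$ if for every $T>0$ and all $A_n\in\mathbb A([0,T])$, $n=0,1,2,\dots$, with $A_n\to_\tau A_0$, $$\int_0^T x_n(t)\,dA_n(t)\to\int_0^T x_0(t)\,dA_0(t)\quad\text{as } n\to\infty .$$ **Theorem 5.3.** Let $x_n\in D([0,\infty))$, $n=0,1,2,\dots$. Then $x_n\stackrel{*}{\to}x_0$ in $D([0,\infty))$ if and only if in each subsequence $(x_{n_k})$ one can find a further subsequence $(x_{n_{k_l}})$ and a strictly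 increasing sequence $T_1<T_2<\dots$ of positive numbers with $T_r\to\infty$ such that for every $r$ $$x^{T_r}_{n_{k_l}}\to_S x_0^{T_r}\ \text{ in } D([0,T_r])\quad\text{as } l\to\infty .$$ -/

import Mathlib

open Set Filter Topology MeasureTheory
open scoped NNReal ENNReal

namespace SkorokhodS

noncomputable section

/-- A real function on a linearly ordered topological space is càdlàg if it is right-continuous
and has (finite) left limits. On `[0, T]` right-continuity at the last point `T` is no condition,
since `Ici T = {T}`, and on `[0, T]` and on `[0, ∞)` the existence of a left limit at the first
point `0` is no condition, since `𝓝[<] 0 = ⊥`. -/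
def IsCadlag {α : Type*} [LinearOrder α] [TopologicalSpace α] (f : α → ℝ) : Prop :=
  (∀ t, ContinuousWithinAt f (Ici t) t) ∧ ∀ t, ∃ l : ℝ, Tendsto f (𝓝[<] t) (𝓝 l)

/-- The time interval `[0, T]`, as a type. -/
abbrev Horizon (T : ℝ≥0) : Type := Icc (0 : ℝ) (T : ℝ)

instance (T : ℝ≥0) : CompactIccSpace (Horizon T) where
  isCompact_Icc {_ _} := IsClosed.isCompact isClosed_Icc

/-- The initial time `0` of `[0, T]`. -/
def origin (T : ℝ≥0) : Horizon T := ⟨0, le_rfl, T.2⟩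

/-- The Skorokhod space `D([0, T])`. -/
structure DFin (T : ℝ≥0) where
  toFun : Horizon T → ℝ
  cadlag : IsCadlag toFun

/-- The Skorokhod space `D([0, ∞))`. -/
structure DInf where
  toFun : ℝ≥0 → ℝ
  cadlag : IsCadlag toFun

/-- The restriction `x^T` of `x ∈ D([0, ∞))` to `[0, T]`. -/
def DInf.restrict (x : DInf) (T : ℝ≥0) : DFin T where
  toFun t := x.toFun ⟨t.1, t.2.1⟩
  cadlag := by
    have hmono : StrictMono (fun t : Horizon T => (⟨t.1, t.2.1⟩ : ℝ≥0)) := fun _ _ h => h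
    have hcont : Continuous (fun t : Horizon T => (⟨t.1, t.2.1⟩ : ℝ≥0)) := by fun_prop
    refine ⟨fun t => ?_, fun t => ?_⟩
    · exact (x.cadlag.1 ⟨t.1, t.2.1⟩).comp hcont.continuousWithinAt
        fun s hs => hmono.monotone hs
    · obtain ⟨l, hl⟩ := x.cadlag.2 ⟨t.1, t.2.1⟩
      exact ⟨l, hl.comp (hcont.continuousWithinAt.tendsto_nhdsWithin fun s hs => hmono hs)⟩

/-- The total variation `‖v‖(T)` of `v` on `[0, T]`, the value `|v(0)|` included. -/
def totalVariation {T : ℝ≥0} (v : Horizon T → ℝ) : ℝ≥0∞ :=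
  ‖v (origin T)‖ₑ + eVariationOn v univ

/-- The space `𝕍([0, T])` of the elements of `D([0, T])` of finite total variation. -/
structure VFin (T : ℝ≥0) extends DFin T where
  finite_variation : totalVariation toFun < ∞

lemma VFin.boundedVariationOn {T : ℝ≥0} (v : VFin T) : BoundedVariationOn v.toFun univ :=
  (lt_of_le_of_lt le_add_self v.finite_variation).ne

/-- The signed Borel measure `dv` on `[0, T]` of `v ∈ 𝕍([0, T])`: it is determined by
`dv([0, t]) = v(t)`. Mathlib's Stieltjes measure of `v` gives mass `v(t) - v(s)` to `(s, t]` and no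
mass to `{0}`; the atom `v(0)` at the origin is added. -/
def VFin.measure {T : ℝ≥0} (v : VFin T) : SignedMeasure (Horizon T) :=
  v.boundedVariationOn.vectorMeasure + VectorMeasure.dirac (origin T) (v.toFun (origin T))

/-- Check of the normalization: `dv([0, t]) = v(t)`. -/
theorem VFin.measure_initial {T : ℝ≥0} (v : VFin T) (t : Horizon T) :
    v.measure (Icc (origin T) t) = v.toFun t := by
  have ho : IsBot (origin T) := fun s => s.2.1
  have hr : v.toFun.rightLim t = v.toFun t := by
    rcases eq_or_neBot (𝓝[>] t) with h | h
    · exact rightLim_eq_of_eq_bot _ h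
    · exact rightLim_eq_of_tendsto
        ((v.cadlag.1 t).mono_left (nhdsWithin_mono _ Ioi_subset_Ici_self))
  rw [VFin.measure, add_apply, BoundedVariationOn.vectorMeasure_Icc _ (ho t),
    VectorMeasure.dirac_apply_of_mem measurableSet_Icc ⟨le_rfl, ho t⟩, leftLim_eq_of_isBot ho, hr]
  ring

/-- The Lebesgue-Stieltjes integral `∫_{[0, T]} f(t) dv(t)`. -/
def stieltjesIntegral {T : ℝ≥0} (f : Horizon T → ℝ) (v : VFin T) : ℝ :=
  ∫ᵛ t, f t ∂•v.measure

/-- Weak-* convergence `v_n ⇒ v_0` in `𝕍([0, T])`. -/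
def WeakStarConv {T : ℝ≥0} (v : ℕ → VFin T) (v₀ : VFin T) : Prop :=
  ∀ f : Horizon T → ℝ, Continuous f →
    Tendsto (fun n => stieltjesIntegral f (v n)) atTop (𝓝 (stieltjesIntegral f v₀))

/-- `S`-convergence `x_n →_S x_0` in `D([0, T])`. -/
def SConv {T : ℝ≥0} (x : ℕ → DFin T) (x₀ : DFin T) : Prop :=
  ∀ ε : ℝ, 0 < ε → ∃ (v : ℕ → VFin T) (v₀ : VFin T),
    (∀ n t, |(x n).toFun t - (v n).toFun t| ≤ ε) ∧
    (∀ t, |x₀.toFun t - v₀.toFun t| ≤ ε) ∧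
    WeakStarConv v v₀

/-- The set `𝔸([0, T])` of continuous functions of finite variation on `[0, T]` that vanish
at `0`. -/
structure AFin (T : ℝ≥0) extends VFin T where
  continuous : Continuous toFun
  map_origin : toFun (origin T) = 0

/-- The convergence `A_n →_τ A_0` in `𝔸([0, T])`: uniform convergence, with bounded total
variations. -/
def TauConv {T : ℝ≥0} (A : ℕ → AFin T) (A₀ : AFin T) : Prop :=
  TendstoUniformly (fun n => (A n).toFun) A₀.toFun atTop ∧
    (⨆ n, totalVariation (A n).toFun) < ∞

/-- The convergence `x_n →* x_0` in `D([0, ∞))`. -/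
def StarConv (x : ℕ → DInf) (x₀ : DInf) : Prop :=
  ∀ T : ℝ≥0, 0 < T → ∀ (A : ℕ → AFin T) (A₀ : AFin T), TauConv A A₀ →
    Tendsto (fun n => stieltjesIntegral ((x n).restrict T).toFun (A n).toVFin) atTop
      (𝓝 (stieltjesIntegral (x₀.restrict T).toFun A₀.toVFin))

end

end SkorokhodS

namespace SkorokhodS

variable {T : ℝ≥0}

lemma isBot_origin (T : ℝ≥0) : IsBot (origin T) := fun s => s.2.1

/-- The final time `T` of `[0, T]`. -/
def terminal (T : ℝ≥0) : Horizon T := ⟨T, T.2, le_rfl⟩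

lemma isTop_terminal (T : ℝ≥0) : IsTop (terminal T) := fun s => s.2.2

lemma Icc_origin (t : Horizon T) : Icc (origin T) t = Iic t :=
  Set.ext fun _ => ⟨fun h => h.2, fun h => ⟨isBot_origin T _, h⟩⟩

lemma Iic_terminal : Iic (terminal T) = univ :=
  Set.eq_univ_of_forall (isTop_terminal T)

lemma signedMeasure_ext {μ ν : SignedMeasure (Horizon T)} (h : ∀ t, μ (Iic t) = ν (Iic t)) :
    μ = ν := by
  refine VectorMeasure.ext_of_generateFrom (range Iic) ?_ ?_ isPiSystem_Iic ?_
  · rintro _ ⟨t, rfl⟩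
    exact h t
  · rw [← borel_eq_generateFrom_Iic]
    exact BorelSpace.measurable_eq
  · rw [← Iic_terminal]
    exact h _

lemma VFin.measure_Iic (v : VFin T) (t : Horizon T) : v.measure (Iic t) = v.toFun t := by
  rw [← Icc_origin, v.measure_initial]

lemma VFin.measure_univ (v : VFin T) : v.measure univ = v.toFun (terminal T) := by
  rw [← Iic_terminal, v.measure_Iic]

lemma VFin.measure_eq (v : VFin T) {μ : SignedMeasure (Horizon T)}
    (h : ∀ t, μ (Iic t) = v.toFun t) : v.measure = μ :=
  signedMeasure_ext fun t => by rw [v.measure_Iic, h]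

instance isFiniteMeasure_variation {X : Type*} [MeasurableSpace X] (μ : SignedMeasure X) :
    IsFiniteMeasure μ.variation := by
  rw [← SignedMeasure.totalVariation_eq_variation, SignedMeasure.totalVariation]
  infer_instance

lemma DFin.rightLim_eq (v : DFin T) : v.toFun.rightLim = v.toFun := by
  ext t
  rcases eq_or_neBot (𝓝[>] t) with h | h
  · exact rightLim_eq_of_eq_bot _ h
  · exact rightLim_eq_of_tendsto
      ((v.cadlag.1 t).mono_left (nhdsWithin_mono _ Ioi_subset_Ici_self))

lemma VFin.variation_vectorMeasure_univ_le (v : VFin T) :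
    v.boundedVariationOn.vectorMeasure.variation univ ≤ eVariationOn v.toFun univ := by
  set hf := v.boundedVariationOn
  set S := hf.stieltjesFunctionRightLim (origin T) with hS
  have hR : v.toFun.rightLim = v.toFun := v.toDFin.rightLim_eq
  have hSo : S (origin T) = 0 := by
    simp [hS, BoundedVariationOn.stieltjesFunctionRightLim, variationOnFromTo.self]
  have hSvar : ∀ a b, a ≤ b → ENNReal.ofReal (S b - S a) = eVariationOn v.toFun (Icc a b) := by
    intro a b hab
    have h := variationOnFromTo.add hf.rightLim.locallyBoundedVariationOn
      (mem_univ (origin T)) (mem_univ a) (mem_univ b)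
    have h1 : S b - S a = variationOnFromTo v.toFun.rightLim univ a b := by
      simp only [hS, BoundedVariationOn.stieltjesFunctionRightLim_apply]
      linarith
    rw [h1, variationOnFromTo.eq_of_le _ _ hab, hR, univ_inter, ENNReal.ofReal_toReal]
    exact ((eVariationOn.mono _ (subset_univ _)).trans_lt hf.lt_top).ne
  have hbot : Function.leftLim S (origin T) = 0 := by rw [leftLim_eq_of_isBot (isBot_origin T), hSo]
  have huniv : S.measure univ = eVariationOn v.toFun univ := by
    rw [← Iic_terminal, ← Icc_origin, S.measure_Icc, hbot,
      ← hSvar _ _ (isBot_origin T _), hSo]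
  have : IsFiniteMeasure S.measure := ⟨by rw [huniv]; exact hf.lt_top⟩
  have A : ∀ s ∈ {s | ∃ u v, u ≤ v ∧ s = Ioc u v},
      ‖AddContent.onIoc v.toFun.rightLim s‖ₑ ≤ S.measure s := by
    rintro s ⟨a, b, hab, rfl⟩
    rw [AddContent.onIoc_apply hab, StieltjesFunction.measure_Ioc, hSvar _ _ hab, hR,
      ← edist_eq_enorm_sub]
    exact eVariationOn.edist_le _ (by grind) (by grind)
  have B : (inferInstance : MeasurableSpace (Horizon T)) =
      MeasurableSpace.generateFrom {s | ∃ u v : Horizon T, u ≤ v ∧ s = Ioc u v} := by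
    rw [BorelSpace.measurable_eq (α := Horizon T)]
    convert! borel_eq_generateFrom_Ioc_le (Horizon T) using 2
    grind only
  have : Nonempty (Horizon T) := ⟨origin T⟩
  obtain ⟨m, hm, hmS⟩ := VectorMeasure.exists_extension_of_isSetSemiring_of_le_measure_of_generateFrom
    IsSetSemiring.Ioc A B
  have hm0 : m {origin T} = 0 := by
    rw [← enorm_eq_zero, ← nonpos_iff_eq_zero]
    refine (hmS _).trans ?_
    rw [S.measure_singleton, hbot, hSo]
    simp
  have hmeq : hf.vectorMeasure = m := by
    refine signedMeasure_ext fun t => ?_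
    have ht : Iic t = {origin T} ∪ Ioc (origin T) t := by
      rw [← Icc_origin, ← Icc_union_Ioc_eq_Icc le_rfl (isBot_origin T t), Icc_self]
    have hd : Disjoint {origin T} (Ioc (origin T) t) := by simp
    rw [ht, VectorMeasure.of_union hd (measurableSet_singleton _) measurableSet_Ioc,
      VectorMeasure.of_union hd (measurableSet_singleton _) measurableSet_Ioc, hm0,
      hm _ ⟨_, _, isBot_origin T t, rfl⟩, AddContent.onIoc_apply (isBot_origin T t),
      hf.vectorMeasure_Ioc (isBot_origin T t), hf.vectorMeasure_singleton,
      leftLim_eq_of_isBot (isBot_origin T), hR]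
    simp
  rw [hmeq, ← huniv]
  exact VectorMeasure.variation_le_of_forall_enorm_le (fun s _ => hmS s) univ

lemma VFin.variation_measure_univ_le (v : VFin T) :
    v.measure.variation univ ≤ totalVariation v.toFun := by
  refine (VectorMeasure.variation_add_le univ).trans ?_
  rw [Measure.add_apply, add_comm, totalVariation]
  gcongr
  · simp
  · exact v.variation_vectorMeasure_univ_le

lemma VFin.abs_stieltjesIntegral_le (v : VFin T) {f : Horizon T → ℝ} {C : ℝ}
    (hf : ∀ t, |f t| ≤ C) : |stieltjesIntegral f v| ≤ C * (totalVariation v.toFun).toReal := by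
  have hC : 0 ≤ C := (abs_nonneg _).trans (hf (origin T))
  have h := VectorMeasure.norm_integral_le_of_norm_le_const (μ := v.measure) (f := f) (C := C)
    (B := ContinuousLinearMap.lsmul ℝ ℝ) (ae_of_all _ fun t => (Real.norm_eq_abs _).trans_le (hf t))
  refine h.trans ?_
  rw [ContinuousLinearMap.opNorm_lsmul, mul_one]
  gcongr
  exact ENNReal.toReal_mono v.finite_variation.ne v.variation_measure_univ_le

/-- Bounded measurable functions. -/
def BddMeas (f : Horizon T → ℝ) : Prop := Measurable f ∧ ∃ C, ∀ t, |f t| ≤ C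

lemma BddMeas.integrable {f : Horizon T → ℝ} (hf : BddMeas f) (μ : SignedMeasure (Horizon T)) :
    μ.Integrable f := by
  obtain ⟨hm, C, hC⟩ := hf
  exact Integrable.of_bound hm.aestronglyMeasurable C (ae_of_all _ hC)

lemma BddMeas.sub {f g : Horizon T → ℝ} (hf : BddMeas f) (hg : BddMeas g) :
    BddMeas fun t => f t - g t := by
  obtain ⟨hm, C, hC⟩ := hf
  obtain ⟨hm', C', hC'⟩ := hg
  exact ⟨hm.sub hm', C + C', fun t => (abs_sub _ _).trans (add_le_add (hC t) (hC' t))⟩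

lemma bddMeas_const (c : ℝ) : BddMeas fun _ : Horizon T => c :=
  ⟨measurable_const, |c|, fun _ => le_rfl⟩

lemma _root_.Continuous.bddMeas {f : Horizon T → ℝ} (hf : Continuous f) : BddMeas f := by
  obtain ⟨C, hC⟩ := isCompact_univ.exists_bound_of_continuousOn hf.continuousOn
  exact ⟨hf.measurable, C, fun t => hC t (mem_univ t)⟩

lemma BddMeas.stieltjesIntegral_sub {f g : Horizon T → ℝ} (hf : BddMeas f) (hg : BddMeas g)
    (v : VFin T) : stieltjesIntegral (fun t => f t - g t) v =
      stieltjesIntegral f v - stieltjesIntegral g v :=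
  VectorMeasure.integral_fun_sub (hf.integrable _) (hg.integrable _)

/-- Functions that are `ε`-close have close integrals. -/
lemma VFin.abs_stieltjesIntegral_sub_le (v : VFin T) {f g : Horizon T → ℝ} (hf : BddMeas f)
    (hg : BddMeas g) {ε : ℝ} (h : ∀ t, |f t - g t| ≤ ε) :
    |stieltjesIntegral f v - stieltjesIntegral g v| ≤ ε * (totalVariation v.toFun).toReal := by
  rw [← hf.stieltjesIntegral_sub hg]
  exact v.abs_stieltjesIntegral_le h

lemma VFin.stieltjesIntegral_const (v : VFin T) (c : ℝ) :
    stieltjesIntegral (fun _ => c) v = c * v.toFun (terminal T) := by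
  simp [stieltjesIntegral, v.measure_univ]

lemma VFin.bddMeas (v : VFin T) : BddMeas v.toFun := by
  have h : MeasurableSet {p : Horizon T × Horizon T | p.2 ≤ p.1} :=
    measurableSet_le measurable_snd measurable_fst
  have hm := (VectorMeasure.stronglyMeasurable_vectorMeasure_prodMk_left
    (ν := v.measure) h).measurable
  refine ⟨?_, v.measure.variation.real univ, fun t => ?_⟩
  · convert hm using 2 with t
    exact (v.measure_Iic t).symm
  · rw [← v.measure_Iic t, ← Real.norm_eq_abs]
    refine (VectorMeasure.norm_measure_le_variation).trans ?_
    exact measureReal_mono (subset_univ _)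

lemma eVariationOn_sum_le {α ι : Type*} [LinearOrder α] [Fintype ι] (c : ι → ℝ) (f : ι → α → ℝ)
    (s : Set α) :
    eVariationOn (fun t => ∑ i, c i * f i t) s ≤ ∑ i, ‖c i‖ₑ * eVariationOn (f i) s := by
  refine iSup_le ?_
  rintro ⟨n, u, hu, hus⟩
  calc ∑ j ∈ Finset.range n, edist (∑ i, c i * f i (u (j + 1))) (∑ i, c i * f i (u j))
      ≤ ∑ j ∈ Finset.range n, ∑ i, ‖c i‖ₑ * edist (f i (u (j + 1))) (f i (u j)) := by
        refine Finset.sum_le_sum fun j _ => ?_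
        rw [edist_eq_enorm_sub, ← Finset.sum_sub_distrib]
        refine (enorm_sum_le _ _).trans (Finset.sum_le_sum fun i _ => ?_)
        rw [← mul_sub, enorm_mul, edist_eq_enorm_sub]
    _ = ∑ i, ‖c i‖ₑ * ∑ j ∈ Finset.range n, edist (f i (u (j + 1))) (f i (u j)) := by
        rw [Finset.sum_comm]
        simp_rw [Finset.mul_sum]
    _ ≤ _ := by
        gcongr with i
        exact eVariationOn.sum_le hu hus

lemma totalVariation_sum_le {ι : Type*} [Fintype ι] (c : ι → ℝ) (f : ι → Horizon T → ℝ) :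
    totalVariation (fun t => ∑ i, c i * f i t) ≤ ∑ i, ‖c i‖ₑ * totalVariation (f i) := by
  simp only [totalVariation, mul_add, Finset.sum_add_distrib]
  gcongr
  · refine (enorm_sum_le _ _).trans (Finset.sum_le_sum fun i _ => ?_)
    rw [enorm_mul]
  · exact eVariationOn_sum_le c f univ

/-- Finite linear combinations in `𝕍([0, T])`. -/
@[simps]
def VFin.lin {ι : Type*} [Fintype ι] (c : ι → ℝ) (v : ι → VFin T) : VFin T where
  toFun t := ∑ i, c i * (v i).toFun t
  cadlag := by
    refine ⟨fun t => ?_, fun t => ?_⟩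
    · exact tendsto_finsetSum _ fun i _ => ((v i).cadlag.1 t).const_mul (c i)
    · choose l hl using fun i => (v i).cadlag.2 t
      exact ⟨∑ i, c i * l i, tendsto_finsetSum _ fun i _ => (hl i).const_mul (c i)⟩
  finite_variation := by
    refine (totalVariation_sum_le c fun i => (v i).toFun).trans_lt ?_
    exact ENNReal.sum_lt_top.2 fun i _ => ENNReal.mul_lt_top (by simp) (v i).finite_variation

lemma VFin.measure_lin {ι : Type*} [Fintype ι] (c : ι → ℝ) (v : ι → VFin T) :
    (VFin.lin c v).measure = ∑ i, c i • (v i).measure := by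
  refine VFin.measure_eq _ fun t => ?_
  rw [FunLike.coe_sum]
  simp [VFin.measure_Iic]

lemma VFin.stieltjesIntegral_lin {ι : Type*} [Fintype ι] (c : ι → ℝ) (v : ι → VFin T)
    {f : Horizon T → ℝ} (hf : BddMeas f) :
    stieltjesIntegral f (VFin.lin c v) = ∑ i, c i * stieltjesIntegral f (v i) := by
  rw [stieltjesIntegral, VFin.measure_lin,
    VectorMeasure.integral_finsetSum_vectorMeasure fun i _ => hf.integrable _]
  simp [stieltjesIntegral]

lemma totalVariation_le_of_monotone {v : Horizon T → ℝ} (hv : Monotone v)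
    (h0 : 0 ≤ v (origin T)) : totalVariation v ≤ ENNReal.ofReal (v (terminal T)) := by
  have h := (hv.monotoneOn univ).eVariationOn_eq (mem_univ (origin T)) (mem_univ (terminal T))
  rw [Icc_origin, Iic_terminal, inter_univ] at h
  have h1 : v (origin T) ≤ v (terminal T) := hv (isBot_origin T _)
  calc totalVariation v ≤ ENNReal.ofReal (v (origin T)) +
        ENNReal.ofReal (v (terminal T) - v (origin T)) := by
        rw [totalVariation, Real.enorm_of_nonneg h0, h]
    _ = _ := by
        rw [← ENNReal.ofReal_add h0 (by linarith)]
        congr 1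
        ring

/-- A time `s ≤ T` as a point of `[0, T]`. -/
def point (s : ℝ≥0) (h : s ≤ T) : Horizon T := ⟨s, s.coe_nonneg, h⟩

/-- The indicator function of `[τ, ∞)`, restricted to `[0, T]`. -/
@[simps]
noncomputable def jump (T τ : ℝ≥0) : VFin T where
  toFun t := if (τ : ℝ) ≤ t then 1 else 0
  cadlag := by
    have hmono : Monotone fun t : Horizon T => if (τ : ℝ) ≤ t then (1 : ℝ) else 0 := by
      intro s t hst
      have : (s : ℝ) ≤ t := hst
      dsimp only
      split_ifs <;> linarith
    refine ⟨fun t => ?_, fun t => ⟨_, hmono.tendsto_leftLim t⟩⟩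
    by_cases h : (τ : ℝ) ≤ t
    · exact (continuousWithinAt_const (b := (1 : ℝ))).congr (fun s hs => if_pos (h.trans hs))
        (if_pos h)
    · have hc : ∀ᶠ s : Horizon T in 𝓝 t, (s : ℝ) < τ :=
        continuous_subtype_val.continuousAt.eventually_lt continuousAt_const (not_le.1 h)
      refine ((continuousAt_const (y := (0 : ℝ))).congr ?_).continuousWithinAt
      filter_upwards [hc] with s hs
      exact (if_neg (not_le.2 hs)).symm
  finite_variation := by
    have hmono : Monotone fun t : Horizon T => if (τ : ℝ) ≤ t then (1 : ℝ) else 0 := by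
      intro s t hst
      have : (s : ℝ) ≤ t := hst
      dsimp only
      split_ifs <;> linarith
    refine (totalVariation_le_of_monotone hmono ?_).trans_lt ENNReal.ofReal_lt_top
    split_ifs <;> norm_num

lemma stieltjesIntegral_jump_of_le {τ : ℝ≥0} (h : τ ≤ T) (f : Horizon T → ℝ) :
    stieltjesIntegral f (jump T τ) = f (point τ h) := by
  have : (jump T τ).measure = VectorMeasure.dirac (point τ h) 1 := by
    refine VFin.measure_eq _ fun t => ?_
    by_cases ht : point τ h ≤ t
    · exact (VectorMeasure.dirac_apply_of_mem measurableSet_Iic (mem_Iic.2 ht)).trans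
        (if_pos ht).symm
    · exact (VectorMeasure.dirac_apply_of_notMem fun h' => ht (mem_Iic.1 h')).trans
        (if_neg ht).symm
  rw [stieltjesIntegral, this, VectorMeasure.integral_dirac]
  simp

lemma stieltjesIntegral_jump_of_lt {τ : ℝ≥0} (h : T < τ) (f : Horizon T → ℝ) :
    stieltjesIntegral f (jump T τ) = 0 := by
  have : (jump T τ).measure = 0 := by
    refine VFin.measure_eq _ fun t => ?_
    exact (if_neg (not_le.2 (lt_of_le_of_lt t.2.2 h))).symm
  rw [stieltjesIntegral, this, VectorMeasure.integral_zero_vectorMeasure]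

/-- For continuous `f`, the integral against a unit jump at `τ ≠ T` depends continuously on `τ`. -/
lemma continuousAt_stieltjesIntegral_jump {f : Horizon T → ℝ} (hf : Continuous f) {τ : ℝ≥0}
    (h : τ ≠ T) : ContinuousAt (fun σ => stieltjesIntegral f (jump T σ)) τ := by
  rcases lt_or_gt_of_ne h with h | h
  · have hc : Continuous fun σ : ℝ≥0 => f (projIcc 0 (T : ℝ) T.coe_nonneg σ) :=
      hf.comp (continuous_projIcc.comp NNReal.continuous_coe)
    refine hc.continuousAt.congr ?_
    filter_upwards [Iio_mem_nhds h] with σ hσ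
    rw [stieltjesIntegral_jump_of_le (le_of_lt hσ), projIcc_of_mem T.coe_nonneg ⟨σ.coe_nonneg, le_of_lt hσ⟩]
    rfl
  · refine (continuousAt_const (y := (0 : ℝ))).congr ?_
    filter_upwards [Ioi_mem_nhds h] with σ hσ
    rw [stieltjesIntegral_jump_of_lt hσ]

/-- The continuous increasing function that vanishes up to `s` and grows with slope `k` from `0`
to `1` after `s`. -/
noncomputable def rampFun (s : ℝ≥0) (k : ℕ) (t : ℝ) : ℝ := max 0 (min 1 (k * (t - s)))

lemma rampFun_nonneg (s : ℝ≥0) (k : ℕ) (t : ℝ) : 0 ≤ rampFun s k t := le_max_left _ _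

lemma rampFun_le_one (s : ℝ≥0) (k : ℕ) (t : ℝ) : rampFun s k t ≤ 1 :=
  max_le zero_le_one (min_le_left _ _)

lemma rampFun_mono (s : ℝ≥0) (k : ℕ) : Monotone (rampFun s k) := fun a b h => by
  unfold rampFun
  gcongr

lemma rampFun_anti (k : ℕ) (t : ℝ) : Antitone fun s => rampFun s k t := fun a b h => by
  have : (a : ℝ) ≤ b := h
  change max 0 (min 1 ((k : ℝ) * (t - b))) ≤ max 0 (min 1 ((k : ℝ) * (t - a)))
  gcongr

lemma rampFun_of_le {s : ℝ≥0} {k : ℕ} {t : ℝ} (h : t ≤ s) : rampFun s k t = 0 := by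
  have : (k : ℝ) * (t - s) ≤ 0 := mul_nonpos_of_nonneg_of_nonpos (by positivity) (by linarith)
  exact max_eq_left ((min_le_right _ _).trans this)

lemma rampFun_eq_one {s : ℝ≥0} {k : ℕ} {t : ℝ} (h : 1 ≤ k * (t - s)) : rampFun s k t = 1 := by
  rw [rampFun, min_eq_left h, max_eq_right zero_le_one]

lemma continuous_rampFun (s : ℝ≥0) (k : ℕ) : Continuous (rampFun s k) := by
  unfold rampFun
  fun_prop

lemma isCadlag_of_continuous {f : Horizon T → ℝ} (hf : Continuous f) : IsCadlag f :=
  ⟨fun _ => hf.continuousWithinAt, fun t => ⟨f t, hf.continuousWithinAt⟩⟩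

lemma totalVariation_rampFun_le (s : ℝ≥0) (k : ℕ) :
    totalVariation (fun t : Horizon T => rampFun s k t) ≤ 1 := by
  refine (totalVariation_le_of_monotone (fun a b h => rampFun_mono s k h)
    (rampFun_nonneg _ _ _)).trans ?_
  rw [ENNReal.ofReal_le_one]
  exact rampFun_le_one _ _ _

/-- `rampFun` as an element of `𝔸([0, T])`. -/
@[simps toVFin_toDFin_toFun]
noncomputable def ramp (T s : ℝ≥0) (k : ℕ) : AFin T where
  toFun t := rampFun s k t
  cadlag := isCadlag_of_continuous ((continuous_rampFun s k).comp continuous_subtype_val)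
  finite_variation := (totalVariation_rampFun_le s k).trans_lt ENNReal.one_lt_top
  continuous := (continuous_rampFun s k).comp continuous_subtype_val
  map_origin := rampFun_of_le s.2

lemma AFin.exists_measure_of_monotone (A : AFin T) (hA : Monotone A.toFun) :
    ∃ ν : Measure (Horizon T), ∃ _ : IsFiniteMeasure ν, A.measure = ν.toSignedMeasure ∧
      (∀ t, ν (Iic t) = ENNReal.ofReal (A.toFun t)) ∧
      ∀ a b, ν (Ioc a b) = ENNReal.ofReal (A.toFun b - A.toFun a) := by
  let S : StieltjesFunction (Horizon T) := ⟨A.toFun, hA, A.cadlag.1⟩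
  have hIic : ∀ t, S.measure (Iic t) = ENNReal.ofReal (A.toFun t) := fun t => by
    have h0 : Function.leftLim A.toFun (origin T) = 0 := by
      rw [leftLim_eq_of_isBot (isBot_origin T), A.map_origin]
    rw [← Icc_origin, S.measure_Icc]
    change ENNReal.ofReal (A.toFun t - Function.leftLim A.toFun (origin T)) = _
    rw [h0, sub_zero]
  have hfin : IsFiniteMeasure S.measure := ⟨by
    rw [← Iic_terminal, hIic]
    exact ENNReal.ofReal_lt_top⟩
  refine ⟨S.measure, hfin, VFin.measure_eq _ fun t => ?_, hIic, fun a b => S.measure_Ioc a b⟩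
  rw [Measure.toSignedMeasure_apply_measurable measurableSet_Iic, measureReal_def, hIic,
    ENNReal.toReal_ofReal]
  rw [← A.map_origin]
  exact hA (isBot_origin T t)

lemma lsmul_real_flip :
    (ContinuousLinearMap.lsmul ℝ ℝ : ℝ →L[ℝ] ℝ →L[ℝ] ℝ).flip = ContinuousLinearMap.lsmul ℝ ℝ := by
  ext
  simp

/-- Integrals against steeper and steeper ramps at `s` converge to the value at `s`. -/
lemma tendsto_stieltjesIntegral_ramp {f : Horizon T → ℝ} (hf : BddMeas f) {s : ℝ≥0}
    (hs : s < T) (hc : ContinuousWithinAt f (Ici (point s hs.le)) (point s hs.le)) :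
    Tendsto (fun k => stieltjesIntegral f (ramp T s k).toVFin) atTop (𝓝 (f (point s hs.le))) := by
  set p := point s hs.le
  rw [Metric.tendsto_atTop]
  intro ε hε
  obtain ⟨δ, hδ, hfδ⟩ := Metric.continuousWithinAt_iff.1 hc (ε / 2) (half_pos hε)
  obtain ⟨K, hK⟩ := exists_nat_gt (1 / min δ (T - s))
  have hm : 0 < min δ ((T : ℝ) - s) := lt_min hδ (sub_pos.2 (NNReal.coe_lt_coe.2 hs))
  refine ⟨K, fun k hk => ?_⟩
  have hkK : (K : ℝ) ≤ k := by exact_mod_cast hk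
  have hkpos : (0 : ℝ) < k := ((one_div_pos.2 hm).trans hK).trans_le hkK
  have hkm : 1 / (k : ℝ) < min δ (T - s) := by
    rw [one_div_lt hkpos hm]
    exact hK.trans_le hkK
  have hkδ := hkm.trans_le (min_le_left _ _)
  have hkT := hkm.trans_le (min_le_right _ _)
  set A := ramp T s k
  obtain ⟨ν, hν, hνA, hIic, hIoc⟩ := A.exists_measure_of_monotone
    fun a b h => rampFun_mono _ _ h
  let s' : Horizon T := ⟨s + 1 / k, by positivity, by linarith⟩
  have hs' : A.toFun s' = 1 := rampFun_eq_one (by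
    simp [s', hkpos.ne'])
  have hT : A.toFun (terminal T) = 1 := le_antisymm (rampFun_le_one _ _ _) (by
    rw [← hs']
    exact rampFun_mono _ _ s'.2.2)
  have hs0 : A.toFun p = 0 := rampFun_of_le le_rfl
  have huniv : ν.real univ = 1 := by
    rw [measureReal_def, ← Iic_terminal, hIic, hT]
    simp
  have h1 : stieltjesIntegral f A.toVFin - f p = ∫ t, (f t - f p) ∂ν := by
    have h2 : f p = stieltjesIntegral (fun _ => f p) A.toVFin := by
      rw [VFin.stieltjesIntegral_const, hT, mul_one]
    conv_lhs => rw [h2]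
    rw [← hf.stieltjesIntegral_sub (bddMeas_const _), stieltjesIntegral, hνA, ← lsmul_real_flip,
      VectorMeasure.integral_toSignedMeasure]
  rw [Real.dist_eq, h1, ← Real.norm_eq_abs]
  have hae : ∀ᵐ t ∂ν, ‖f t - f p‖ ≤ ε / 2 := by
    have e1 : ν (Iic p) = 0 := by rw [hIic, hs0, ENNReal.ofReal_zero]
    have e2 : ν (Ioc s' (terminal T)) = 0 := by rw [hIoc, hs', hT, sub_self, ENNReal.ofReal_zero]
    filter_upwards [measure_eq_zero_iff_ae_notMem.1 e1, measure_eq_zero_iff_ae_notMem.1 e2]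
      with t ht1 ht2
    have hst : p < t := not_le.1 ht1
    have hts : t ≤ s' := not_lt.1 fun h => ht2 ⟨h, isTop_terminal T t⟩
    have hts' : (t : ℝ) ≤ s + 1 / k := hts
    rw [← dist_eq_norm]
    refine (hfδ hst.le ?_).le
    rw [Subtype.dist_eq, Real.dist_eq, abs_of_pos (sub_pos.2 (show (p : ℝ) < t from hst))]
    change (t : ℝ) - s < δ
    linarith
  refine (norm_integral_le_of_norm_le_const hae).trans_lt ?_
  rw [huniv]
  linarith

/-- Stopping the time at `T`. -/
def stopAt (T : ℝ≥0) {T' : ℝ≥0} (t : Horizon T') : Horizon T :=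
  ⟨min t T, le_min t.2.1 T.2, min_le_right _ _⟩

lemma continuous_stopAt (T T' : ℝ≥0) : Continuous (stopAt T : Horizon T' → Horizon T) := by
  unfold stopAt
  fun_prop

/-- The inclusion of `[0, T]` into `[0, T']`. -/
def incl {T T' : ℝ≥0} (h : T ≤ T') (t : Horizon T) : Horizon T' :=
  ⟨t, t.2.1, t.2.2.trans h⟩

lemma continuous_incl {T' : ℝ≥0} (h : T ≤ T') : Continuous (incl h) := by
  unfold incl
  fun_prop

lemma AFin.measure_singleton (A : AFin T) (t : Horizon T) : A.measure {t} = 0 := by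
  have h1 : A.toFun.leftLim t = A.toFun t := by
    rcases eq_or_neBot (𝓝[<] t) with h | h
    · exact leftLim_eq_of_eq_bot _ h
    · exact leftLim_eq_of_tendsto A.continuous.continuousWithinAt
  have h2 : A.toFun.rightLim t = A.toFun t := congrFun A.rightLim_eq t
  rw [VFin.measure, add_apply, BoundedVariationOn.vectorMeasure_singleton, h1, h2, A.map_origin]
  simp

lemma AFin.measure_Ici (A : AFin T) (t : Horizon T) :
    A.measure (Ici t) = A.toFun (terminal T) - A.toFun t := by
  have h1 : A.measure (Iic t ∪ Ioi t) = A.toFun (terminal T) := by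
    rw [Iic_union_Ioi, A.measure_univ]
  have h2 : A.measure ({t} ∪ Ioi t) = A.measure (Ici t) := by
    congr 1
    ext s
    simp [le_iff_eq_or_lt]
  rw [VectorMeasure.of_union (by simp) measurableSet_Iic measurableSet_Ioi, A.measure_Iic] at h1
  rw [VectorMeasure.of_union (by simp) (measurableSet_singleton t) measurableSet_Ioi,
    A.measure_singleton, zero_add] at h2
  linarith

/-- Integration by parts (Fubini) for an integrator that does not charge points. -/
lemma stieltjesIntegral_incl {T' : ℝ≥0} (h : T ≤ T') (v : VFin T') (A : AFin T) :
    stieltjesIntegral (fun s => v.toFun (incl h s)) A.toVFin =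
      stieltjesIntegral (fun t => A.toFun (terminal T) - A.toFun (stopAt T t)) v := by
  set B : ℝ →L[ℝ] ℝ →L[ℝ] ℝ := ContinuousLinearMap.lsmul ℝ ℝ with hB
  let S : Set (Horizon T × Horizon T') := {p | p.2.1 ≤ p.1.1}
  have hS : MeasurableSet S := measurableSet_le (by fun_prop) (by fun_prop)
  have hS' : MeasurableSet (Prod.swap ⁻¹' S) := hS.preimage measurable_swap
  have e1 := VectorMeasure.prod_flip_apply_eq_integral (μ := A.measure) (ν := v.measure) (B := B) hS
  have e2 := VectorMeasure.prod_flip_apply_eq_integral (μ := v.measure) (ν := A.measure) (B := B) hS'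
  have e3 : v.measure.prod A.measure B.flip = (A.measure.prod v.measure B.flip).map Prod.swap := by
    refine VectorMeasure.prod_eq_of_forall_apply_prod fun s t hs ht => ?_
    rw [VectorMeasure.map_apply _ measurable_swap (hs.prod ht), preimage_swap_prod,
      VectorMeasure.prod_apply]
    simp [hB, mul_comm]
  rw [e3, VectorMeasure.map_apply _ measurable_swap hS', ← preimage_comp, Prod.swap_swap_eq,
    preimage_id, e1] at e2
  have f1 : ∀ s, v.measure (Prod.mk s ⁻¹' S) = v.toFun (incl h s) := fun s => by
    rw [← v.measure_Iic]
    rfl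
  have f2 : ∀ t, A.measure (Prod.mk t ⁻¹' (Prod.swap ⁻¹' S)) =
      A.toFun (terminal T) - A.toFun (stopAt T t) := fun t => by
    by_cases ht : (t : ℝ) ≤ T
    · rw [← A.measure_Ici]
      congr 1
      ext s
      change t.1 ≤ s.1 ↔ min t.1 T ≤ s.1
      rw [min_eq_left ht]
    · have hst : stopAt T t = terminal T := Subtype.ext (min_eq_right (not_le.1 ht).le)
      rw [hst, sub_self]
      convert A.measure.empty
      ext s
      simp only [mem_preimage, mem_empty_iff_false, iff_false]
      exact fun hs : t.1 ≤ s.1 => ht (hs.trans s.2.2)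
  simp_rw [f1, f2] at e2
  exact e2

lemma DInf.measurable (x : DInf) : Measurable x.toFun := by
  let g : ℕ → ℝ≥0 → ℝ≥0 := fun n t => ((⌊(n + 1 : ℝ≥0) * t⌋₊ + 1 : ℕ) : ℝ≥0) / (n + 1)
  have hpos : ∀ n : ℕ, (0 : ℝ≥0) < n + 1 := fun n => by positivity
  have hlt : ∀ n t, t < g n t := fun n t => by
    simp only [g]
    rw [lt_div_iff₀ (hpos n), mul_comm]
    push_cast
    exact Nat.lt_floor_add_one _
  have hle : ∀ n t, g n t ≤ t + 1 / (n + 1) := fun n t => by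
    simp only [g]
    rw [div_le_iff₀ (hpos n), add_mul t, one_div, inv_mul_cancel₀ (hpos n).ne']
    push_cast
    gcongr
    rw [mul_comm]
    exact Nat.floor_le zero_le
  refine measurable_of_tendsto_metrizable (f := fun n t => x.toFun (g n t)) (fun n => ?_) ?_
  · have h1 : Measurable fun t : ℝ≥0 => ⌊(n + 1 : ℝ≥0) * t⌋₊ :=
      Nat.measurable_floor.comp (measurable_const.mul measurable_id)
    exact (measurable_from_nat
      (f := fun j : ℕ => x.toFun (((j + 1 : ℕ) : ℝ≥0) / (n + 1)))).comp h1
  · rw [tendsto_pi_nhds]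
    intro t
    refine (x.cadlag.1 t).tendsto.comp (tendsto_nhdsWithin_iff.2 ⟨?_, ?_⟩)
    · have h0 : Tendsto (fun n : ℕ => t + 1 / ((n : ℝ≥0) + 1)) atTop (𝓝 (t + 0)) :=
        tendsto_const_nhds.add tendsto_one_div_add_atTop_nhds_zero_nat
      rw [add_zero] at h0
      exact tendsto_of_tendsto_of_tendsto_of_le_of_le tendsto_const_nhds h0
        (fun n => (hlt n t).le) (fun n => hle n t)
    · exact Eventually.of_forall fun n => (hlt n t).le

lemma DInf.exists_bound (x : DInf) (R : ℝ≥0) : ∃ C, ∀ t ≤ R, |x.toFun t| ≤ C := by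
  have h := (isCompact_Icc (a := (0 : ℝ≥0)) (b := R)).induction_on
    (p := fun s => ∃ C, ∀ t ∈ s, |x.toFun t| ≤ C) ⟨0, by simp⟩
    (fun s t hst ⟨C, hC⟩ => ⟨C, fun u hu => hC u (hst hu)⟩)
    (fun s t ⟨C, hC⟩ ⟨C', hC'⟩ => ⟨max C C', by
      rintro u (hu | hu)
      · exact (hC u hu).trans (le_max_left _ _)
      · exact (hC' u hu).trans (le_max_right _ _)⟩) (fun t _ => ?_)
  · obtain ⟨C, hC⟩ := h
    exact ⟨C, fun t ht => hC t ⟨zero_le, ht⟩⟩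
  · obtain ⟨l, hl⟩ := x.cadlag.2 t
    have h1 : ∀ᶠ u in 𝓝[<] t, |x.toFun u| < |l| + 1 :=
      hl.abs.eventually (gt_mem_nhds (lt_add_one _))
    have h2 : ∀ᶠ u in 𝓝[≥] t, |x.toFun u| < |x.toFun t| + 1 :=
      (x.cadlag.1 t).tendsto.abs.eventually (gt_mem_nhds (lt_add_one _))
    refine ⟨{u | |x.toFun u| ≤ max (|l| + 1) (|x.toFun t| + 1)}, ?_, _, fun u hu => hu⟩
    apply mem_nhdsWithin_of_mem_nhds
    rw [← nhdsLT_sup_nhdsGE t]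
    refine mem_sup.2 ⟨?_, ?_⟩
    · filter_upwards [h1] with u hu using hu.le.trans (le_max_left _ _)
    · filter_upwards [h2] with u hu using hu.le.trans (le_max_right _ _)

lemma DInf.bddMeas_restrict (x : DInf) (T : ℝ≥0) : BddMeas (x.restrict T).toFun := by
  refine ⟨x.measurable.comp (by fun_prop), ?_⟩
  obtain ⟨C, hC⟩ := x.exists_bound T
  exact ⟨C, fun t => hC _ t.2.2⟩

/-- Integration against `v`, as a continuous linear form on `C([0, T])`. -/
noncomputable def VFin.toCLM (v : VFin T) : C(Horizon T, ℝ) →L[ℝ] ℝ :=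
  LinearMap.mkContinuous
    { toFun := fun f => stieltjesIntegral f v
      map_add' := fun f g => VectorMeasure.integral_fun_add (f.continuous.bddMeas.integrable _)
        (g.continuous.bddMeas.integrable _)
      map_smul' := fun c f => VectorMeasure.integral_fun_smul _ _ c _ }
    (totalVariation v.toFun).toReal fun f => by
      rw [mul_comm]
      exact v.abs_stieltjesIntegral_le fun t => f.norm_coe_le_norm t

lemma WeakStarConv.tendsto_of_tendstoUniformly {v : ℕ → VFin T} {v₀ : VFin T}
    (h : WeakStarConv v v₀) {f : ℕ → Horizon T → ℝ} {f₀ : Horizon T → ℝ}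
    (hf : ∀ n, Continuous (f n)) (hf₀ : Continuous f₀) (hu : TendstoUniformly f f₀ atTop) :
    Tendsto (fun n => stieltjesIntegral (f n) (v n)) atTop (𝓝 (stieltjesIntegral f₀ v₀)) := by
  obtain ⟨C, hC⟩ := banach_steinhaus (g := fun n => (v n).toCLM) fun f => by
    obtain ⟨C, hC⟩ := (h f f.continuous).norm.bddAbove_range
    exact ⟨C, fun n => hC ⟨n, rfl⟩⟩
  have hC0 : 0 ≤ C := (norm_nonneg _).trans (hC 0)
  let F : ℕ → C(Horizon T, ℝ) := fun n => ⟨f n, hf n⟩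
  let F₀ : C(Horizon T, ℝ) := ⟨f₀, hf₀⟩
  have hF : Tendsto F atTop (𝓝 F₀) := ContinuousMap.tendsto_iff_tendstoUniformly.2 hu
  have hd : Tendsto (fun n => (v n).toCLM (F n - F₀)) atTop (𝓝 0) := by
    have h0 : Tendsto (fun n => C * ‖F n - F₀‖) atTop (𝓝 0) := by
      have := (tendsto_iff_norm_sub_tendsto_zero.1 hF).const_mul C
      rwa [mul_zero] at this
    refine squeeze_zero_norm (fun n => ?_) h0
    exact ((v n).toCLM.le_opNorm _).trans (by gcongr; exact hC n)
  have := hd.add (h f₀ hf₀)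
  rw [zero_add] at this
  refine this.congr fun n => ?_
  rw [map_sub]
  exact sub_add_cancel _ _

lemma TauConv.exists_bound {A : ℕ → AFin T} {A₀ : AFin T} (h : TauConv A A₀) :
    ∃ C : ℝ, 0 < C ∧ (∀ n, (totalVariation (A n).toFun).toReal ≤ C) ∧
      (totalVariation A₀.toFun).toReal ≤ C := by
  refine ⟨max 1 (max (⨆ n, totalVariation (A n).toFun).toReal (totalVariation A₀.toFun).toReal),
    lt_max_of_lt_left one_pos, fun n => ?_, ?_⟩
  · refine le_max_of_le_right (le_max_of_le_left ?_)
    exact ENNReal.toReal_mono h.2.ne (le_iSup (fun n => totalVariation (A n).toFun) n)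
  · exact le_max_of_le_right (le_max_right _ _)

/-- `S`-convergence on `[0, T']` controls the integrals against `τ`-convergent integrators on
`[0, T]`, `T ≤ T'`. -/
lemma SConv.tendsto_stieltjesIntegral {T' : ℝ≥0} (hT : T ≤ T') {x : ℕ → DInf} {x₀ : DInf}
    (hx : SConv (fun n => (x n).restrict T') (x₀.restrict T')) {A : ℕ → AFin T} {A₀ : AFin T}
    (hA : TauConv A A₀) :
    Tendsto (fun n => stieltjesIntegral ((x n).restrict T).toFun (A n).toVFin) atTop
      (𝓝 (stieltjesIntegral (x₀.restrict T).toFun A₀.toVFin)) := by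
  obtain ⟨C, hC, hAC, hA₀C⟩ := hA.exists_bound
  rw [Metric.tendsto_atTop]
  intro ε hε
  obtain ⟨v, v₀, hv, hv₀, hconv⟩ := hx (ε / (4 * C)) (by positivity)
  have hlim : Tendsto (fun n => stieltjesIntegral (fun s => (v n).toFun (incl hT s)) (A n).toVFin)
      atTop (𝓝 (stieltjesIntegral (fun s => v₀.toFun (incl hT s)) A₀.toVFin)) := by
    simp_rw [stieltjesIntegral_incl]
    refine hconv.tendsto_of_tendstoUniformly (fun n => ?_) ?_ ?_
    · exact continuous_const.sub ((A n).continuous.comp (continuous_stopAt T T'))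
    · exact continuous_const.sub (A₀.continuous.comp (continuous_stopAt T T'))
    · exact ((hA.1.tendsto_at _).tendstoUniformly_const).sub (hA.1.comp (stopAt T))
  obtain ⟨N, hN⟩ := Metric.tendsto_atTop.1 hlim (ε / 4) (by positivity)
  have hcomp : ∀ w : VFin T', BddMeas fun s => w.toFun (incl hT s) := fun w => by
    obtain ⟨hm, K, hK⟩ := w.bddMeas
    exact ⟨hm.comp (continuous_incl hT).measurable, K, fun t => hK _⟩
  have hb : ∀ r : ℝ, r ≤ C → ε / (4 * C) * r ≤ ε / 4 := fun r hr => by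
    calc ε / (4 * C) * r ≤ ε / (4 * C) * C := by gcongr
      _ = ε / 4 := by field_simp
  refine ⟨N, fun n hn => ?_⟩
  have h1 := ((A n).toVFin.abs_stieltjesIntegral_sub_le ((x n).bddMeas_restrict T) (hcomp (v n))
    (fun t => hv n (incl hT t))).trans (hb _ (hAC n))
  have h2 := (A₀.toVFin.abs_stieltjesIntegral_sub_le (x₀.bddMeas_restrict T) (hcomp v₀)
    (fun t => hv₀ (incl hT t))).trans (hb _ hA₀C)
  have h3 := hN n hn
  rw [Real.dist_eq] at h3 ⊢
  rw [abs_le] at h1 h2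
  rw [abs_lt] at h3 ⊢
  constructor <;> linarith [h1.1, h1.2, h2.1, h2.2, h3.1, h3.2]

lemma starConv_of_subseq {x : ℕ → DInf} {x₀ : DInf}
    (h : ∀ k : ℕ → ℕ, StrictMono k → ∃ l : ℕ → ℕ, StrictMono l ∧ ∃ T : ℕ → ℝ≥0,
      (∀ r, 0 < T r) ∧ StrictMono T ∧ Tendsto T atTop atTop ∧
        ∀ r, SConv (fun i => (x (k (l i))).restrict (T r)) (x₀.restrict (T r))) :
    StarConv x x₀ := by
  intro T _ A A₀ hA
  refine tendsto_of_subseq_tendsto fun ns hns => ?_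
  obtain ⟨φ, -, hφ⟩ := strictMono_subseq_of_tendsto_atTop hns
  obtain ⟨l, hl, T', -, -, hT', hS⟩ := h _ hφ
  obtain ⟨r, hr⟩ := (hT'.eventually_ge_atTop T).exists
  refine ⟨fun i => φ (l i), ?_⟩
  refine (hS r).tendsto_stieltjesIntegral hr (A := fun i => A (ns (φ (l i)))) ⟨?_, ?_⟩
  · intro u hu
    exact (hφ.tendsto_atTop.comp hl.tendsto_atTop).eventually (hA.1 u hu)
  · exact (iSup_comp_le (fun n => totalVariation (A n).toFun) fun i => ns (φ (l i))).trans_lt hA.2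

lemma StarConv.tendsto_subseq {x : ℕ → DInf} {x₀ : DInf} (h : StarConv x x₀) {k : ℕ → ℕ}
    (hk : StrictMono k) (hT : 0 < T) {A : ℕ → AFin T} {A₀ : AFin T} (hA : TauConv A A₀) :
    Tendsto (fun n => stieltjesIntegral ((x (k n)).restrict T).toFun (A n).toVFin) atTop
      (𝓝 (stieltjesIntegral (x₀.restrict T).toFun A₀.toVFin)) := by
  let B : ℕ → AFin T := Function.extend k A fun _ => A₀
  have hB : ∀ n, B (k n) = A n := fun n => hk.injective.extend_apply _ _ _
  have hB' : ∀ m, (¬∃ n, k n = m) → B m = A₀ := fun m hm => Function.extend_apply' _ _ _ hm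
  have hτ : TauConv B A₀ := by
    refine ⟨fun u hu => ?_, ?_⟩
    · obtain ⟨N, hN⟩ := eventually_atTop.1 (hA.1 u hu)
      filter_upwards [eventually_ge_atTop (k N)] with m hm t
      by_cases h : ∃ n, k n = m
      · obtain ⟨n, rfl⟩ := h
        rw [hB]
        exact hN n (hk.le_iff_le.1 hm) t
      · rw [hB' m h]
        exact refl_mem_uniformity hu
    · refine lt_of_le_of_lt (b := max (⨆ n, totalVariation (A n).toFun) (totalVariation A₀.toFun))
        (iSup_le fun m => ?_) (max_lt hA.2 A₀.finite_variation)
      by_cases h : ∃ n, k n = m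
      · obtain ⟨n, rfl⟩ := h
        rw [hB]
        exact le_max_of_le_left (le_iSup (fun n => totalVariation (A n).toFun) n)
      · rw [hB' m h]
        exact le_max_right _ _
  have := (h T hT B A₀ hτ).comp hk.tendsto_atTop
  refine this.congr fun n => ?_
  rw [Function.comp_apply, hB]

lemma StarConv.comp {x : ℕ → DInf} {x₀ : DInf} (h : StarConv x x₀) {k : ℕ → ℕ}
    (hk : StrictMono k) : StarConv (fun n => x (k n)) x₀ :=
  fun _ hT _ _ hA => h.tendsto_subseq hk hT hA

/-- The zero function as an element of `𝔸([0, T])`. -/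
def AFin.zero (T : ℝ≥0) : AFin T where
  toFun _ := 0
  cadlag := isCadlag_of_continuous continuous_const
  finite_variation := by
    refine (totalVariation_le_of_monotone monotone_const le_rfl).trans_lt ?_
    simp
  continuous := continuous_const
  map_origin := rfl

lemma AFin.stieltjesIntegral_zero (f : Horizon T → ℝ) :
    stieltjesIntegral f (AFin.zero T).toVFin = 0 := by
  have : (AFin.zero T).measure = 0 := VFin.measure_eq _ fun t => rfl
  rw [stieltjesIntegral, this, VectorMeasure.integral_zero_vectorMeasure]

/-- Along a `*`-convergent sequence, integrals against uniformly small integrators of bounded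
variation cannot stay away from zero. -/
lemma StarConv.not_frequently {x : ℕ → DInf} {x₀ : DInf} (h : StarConv x x₀) (hT : 0 < T)
    {η : ℝ} (hη : 0 < η) {C : ℝ≥0∞} (hC : C < ∞) :
    ¬∀ N : ℕ, ∃ᶠ n in atTop, ∃ A : AFin T, (∀ t, |A.toFun t| ≤ 1 / (N + 1)) ∧
      totalVariation A.toFun ≤ C ∧ η ≤ |stieltjesIntegral ((x n).restrict T).toFun A.toVFin| := by
  intro hf
  obtain ⟨φ, hφ, hA⟩ := extraction_forall_of_frequently hf
  choose A hA1 hA2 hA3 using hA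
  have hτ : TauConv A (AFin.zero T) := by
    refine ⟨?_, (iSup_le hA2).trans_lt hC⟩
    rw [Metric.tendstoUniformly_iff]
    intro ε hε
    filter_upwards [(tendsto_one_div_add_atTop_nhds_zero_nat (𝕜 := ℝ)).eventually
      (gt_mem_nhds hε)] with n hn t
    rw [dist_comm, Real.dist_eq]
    change |(A n).toFun t - 0| < ε
    rw [sub_zero]
    exact (hA1 n t).trans_lt hn
  have hlim := (h.tendsto_subseq hφ hT hτ).abs
  rw [AFin.stieltjesIntegral_zero, abs_zero] at hlim
  exact absurd (ge_of_tendsto' hlim hA3) (not_le.2 hη)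

/-- Linear combinations of ramps of slope `k`. -/
@[simps toVFin]
noncomputable def rampSum {ι : Type*} [Fintype ι] (T : ℝ≥0) (c : ι → ℝ) (s : ι → ℝ≥0) (k : ℕ) :
    AFin T where
  toVFin := VFin.lin c fun i => (ramp T (s i) k).toVFin
  continuous := continuous_finsetSum _ fun i _ => continuous_const.mul (ramp T (s i) k).continuous
  map_origin := by
    simp only [VFin.lin_toFun]
    exact Finset.sum_eq_zero fun i _ => by rw [(ramp T (s i) k).map_origin, mul_zero]

lemma rampSum_apply {ι : Type*} [Fintype ι] (c : ι → ℝ) (s : ι → ℝ≥0) (k : ℕ) (t : Horizon T) :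
    (rampSum T c s k).toFun t = ∑ i, c i * rampFun (s i) k t := rfl

lemma totalVariation_rampSum_le {ι : Type*} [Fintype ι] (c : ι → ℝ) (s : ι → ℝ≥0) (k : ℕ) :
    totalVariation (rampSum T c s k).toFun ≤ ∑ i, ‖c i‖ₑ := by
  refine (totalVariation_sum_le c fun i => (ramp T (s i) k).toFun).trans
    (Finset.sum_le_sum fun i _ => ?_)
  exact mul_le_of_le_one_right' (totalVariation_rampFun_le _ _)

lemma DInf.tendsto_stieltjesIntegral_rampSum {ι : Type*} [Fintype ι] (x : DInf) (c : ι → ℝ)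
    {s : ι → ℝ≥0} (hs : ∀ i, s i < T) :
    Tendsto (fun k => stieltjesIntegral (x.restrict T).toFun (rampSum T c s k).toVFin) atTop
      (𝓝 (∑ i, c i * x.toFun (s i))) := by
  simp_rw [rampSum_toVFin, VFin.stieltjesIntegral_lin _ _ (x.bddMeas_restrict T)]
  refine tendsto_finsetSum _ fun i _ => Tendsto.const_mul _ ?_
  exact tendsto_stieltjesIntegral_ramp (x.bddMeas_restrict T) (hs i)
    ((x.restrict T).cadlag.1 _)

/-- A `*`-convergent sequence is locally uniformly bounded. -/
lemma StarConv.exists_bound {x : ℕ → DInf} {x₀ : DInf} (h : StarConv x x₀) (R : ℝ≥0) :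
    ∃ M, ∀ n, ∀ t ≤ R, |(x n).toFun t| ≤ M := by
  by_contra! hM
  refine h.not_frequently (T := R + 1) (by positivity) one_pos ENNReal.one_lt_top fun N => ?_
  rw [frequently_atTop]
  intro n₀
  choose C hC using fun n => (x n).exists_bound R
  obtain ⟨n, t, ht, hn⟩ := hM (max (N + 1) (∑ m ∈ Finset.range n₀, |C m|))
  have hn₀ : n₀ ≤ n := by
    by_contra! hlt
    have h1 := (hC n t ht).trans (le_abs_self _)
    have h2 := Finset.single_le_sum (f := fun m => |C m|) (fun m _ => abs_nonneg _)
      (Finset.mem_range.2 hlt)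
    exact absurd (h1.trans (h2.trans (le_max_right _ _))) (not_le.2 hn)
  have hN : (0 : ℝ) < N + 1 := by positivity
  have hlim := ((x n).tendsto_stieltjesIntegral_rampSum (T := R + 1) (ι := Unit)
    (fun _ => 1 / ((N : ℝ) + 1)) (s := fun _ => t) (fun _ => ht.trans_lt (lt_add_one R))).abs
  have hgt : (1 : ℝ) < |∑ _i : Unit, 1 / ((N : ℝ) + 1) * (x n).toFun t| := by
    rw [Fintype.sum_unique, abs_mul, abs_of_pos (by positivity), one_div, inv_mul_eq_div,
      lt_div_iff₀ hN, one_mul]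
    exact (le_max_left _ _).trans_lt hn
  obtain ⟨k, hk⟩ := (hlim.eventually (lt_mem_nhds hgt)).exists
  refine ⟨n, hn₀, _, fun u => ?_, ?_, hk.le⟩
  · rw [rampSum_apply, Fintype.sum_unique, abs_of_nonneg (mul_nonneg (by positivity)
      (rampFun_nonneg _ _ _))]
    exact mul_le_of_le_one_right (by positivity) (rampFun_le_one _ _ _)
  · refine (totalVariation_rampSum_le _ _ _).trans ?_
    rw [Fintype.sum_unique, Real.enorm_of_nonneg (by positivity), ENNReal.ofReal_le_one,
      div_le_one hN]
    linarith [(Nat.cast_nonneg N : (0 : ℝ) ≤ N)]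

/-- The step function with value `b` before the jumps, and jumps `c i` at `τ i`. -/
noncomputable def stepFun {ι : Type*} [Fintype ι] (c : ι → ℝ) (τ : ι → ℝ≥0) (t : ℝ≥0) : ℝ :=
  ∑ i, c i * if τ i ≤ t then 1 else 0

/-- `x` is `ε`-close on `[a, R]` to `x a` plus a step function with `N` jumps, of size at
most `B`. -/
def StepApprox (x : DInf) (R : ℝ≥0) (ε B : ℝ) (N : ℕ) (a : ℝ≥0) : Prop :=
  ∃ (c : Fin N → ℝ) (τ : Fin N → ℝ≥0), (∀ i, |c i| ≤ B) ∧ (∀ i, a ≤ τ i ∧ τ i ≤ R) ∧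
    ∀ t, a ≤ t → t ≤ R → |x.toFun t - (x.toFun a + stepFun c τ t)| ≤ ε

/-- `b` is the first time after `a` when the increment of `x` since `a` reaches `ε`. -/
def NextJump (x : DInf) (R : ℝ≥0) (ε : ℝ) (a b : ℝ≥0) : Prop :=
  a < b ∧ b ≤ R ∧ ε ≤ |x.toFun b - x.toFun a| ∧
    ∀ t, a ≤ t → t < b → |x.toFun t - x.toFun a| ≤ ε

variable {x : DInf} {R a b : ℝ≥0} {ε B : ℝ} {N : ℕ}

lemma StepApprox.of_forall_le (hB : 0 ≤ B) (ha : a ≤ R)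
    (h : ∀ t, a ≤ t → t ≤ R → |x.toFun t - x.toFun a| ≤ ε) : StepApprox x R ε B N a := by
  refine ⟨fun _ => 0, fun _ => a, fun _ => by simpa using hB, fun _ => ⟨le_rfl, ha⟩, fun t hat htR => ?_⟩
  simpa [stepFun] using h t hat htR

lemma StepApprox.succ (hB : 0 ≤ B) (ha : a ≤ R) (h : StepApprox x R ε B N a) :
    StepApprox x R ε B (N + 1) a := by
  obtain ⟨c, τ, hc, hτ, h⟩ := h
  refine ⟨Fin.cons 0 c, Fin.cons a τ, fun i => ?_, fun i => ?_, fun t hat htR => ?_⟩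
  · refine Fin.cases ?_ (fun j => ?_) i
    · simpa using hB
    · simpa using hc j
  · refine Fin.cases ?_ (fun j => ?_) i
    · simpa using ha
    · simpa using hτ j
  · simpa [stepFun, Fin.sum_univ_succ] using h t hat htR

lemma StepApprox.mono (hB : 0 ≤ B) (ha : a ≤ R) {M : ℕ} (hNM : N ≤ M)
    (h : StepApprox x R ε B N a) : StepApprox x R ε B M a := by
  induction M, hNM using Nat.le_induction with
  | base => exact h
  | succ M _ ih => exact ih.succ hB ha

lemma StepApprox.cons (hB : ∀ s ≤ R, ∀ t ≤ R, |x.toFun t - x.toFun s| ≤ B)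
    (hab : NextJump x R ε a b) (h : StepApprox x R ε B N b) : StepApprox x R ε B (N + 1) a := by
  obtain ⟨c, τ, hc, hτ, h⟩ := h
  obtain ⟨hlt, hbR, -, hx⟩ := hab
  refine ⟨Fin.cons (x.toFun b - x.toFun a) c, Fin.cons b τ, fun i => ?_, fun i => ?_,
    fun t hat htR => ?_⟩
  · refine Fin.cases ?_ (fun j => ?_) i
    · simpa using hB a (hlt.le.trans hbR) b hbR
    · simpa using hc j
  · refine Fin.cases ?_ (fun j => ?_) i
    · simpa using ⟨hlt.le, hbR⟩
    · simpa using ⟨hlt.le.trans (hτ j).1, (hτ j).2⟩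
  · simp only [stepFun, Fin.sum_univ_succ, Fin.cons_zero, Fin.cons_succ]
    rcases lt_or_ge t b with htb | hbt
    · have h0 : ∀ j, ¬τ j ≤ t := fun j => not_le.2 (htb.trans_le (hτ j).1)
      simpa [h0, not_le.2 htb] using hx t hat htb
    · rw [if_pos hbt, mul_one]
      convert h t hbt htR using 2
      simp only [stepFun]
      ring

lemma DInf.forall_le_or_exists_nextJump (x : DInf) (hε : 0 < ε) (a R : ℝ≥0) :
    (∀ t, a ≤ t → t ≤ R → |x.toFun t - x.toFun a| ≤ ε) ∨ ∃ b, NextJump x R ε a b := by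
  by_contra! hcon
  obtain ⟨⟨t, hat, htR, ht⟩, hb⟩ := hcon
  let S : Set ℝ≥0 := {t | a ≤ t ∧ t ≤ R ∧ ε < |x.toFun t - x.toFun a|}
  have hS : S.Nonempty := ⟨t, hat, htR, ht⟩
  have hglb : IsGLB S (sInf S) := isGLB_csInf hS (OrderBot.bddBelow S)
  have hlow : ∀ t, a ≤ t → t < sInf S → |x.toFun t - x.toFun a| ≤ ε := fun u hau hu => by
    by_contra! h
    have huR : u ≤ R := (hu.trans_le (hglb.1 ⟨hat, htR, ht⟩)).le.trans htR
    exact absurd (hglb.1 ⟨hau, huR, h⟩) (not_le.2 hu)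
  have hge : ε ≤ |x.toFun (sInf S) - x.toFun a| := by
    by_contra! h
    have hc : Tendsto (fun u => |x.toFun u - x.toFun a|) (𝓝[≥] (sInf S))
        (𝓝 |x.toFun (sInf S) - x.toFun a|) :=
      ((x.cadlag.1 (sInf S)).tendsto.sub tendsto_const_nhds).abs
    obtain ⟨u, hu, hu'⟩ := ((hglb.frequently_mem hS).and_eventually
      (hc.eventually (gt_mem_nhds h))).exists
    exact absurd hu.2.2 (not_lt.2 hu'.le)
  refine hb (sInf S) ⟨lt_of_le_of_ne (hglb.2 fun u hu => hu.1) ?_,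
    (hglb.1 ⟨hat, htR, ht⟩).trans htR, hge, hlow⟩
  intro heq
  rw [← heq, sub_self, abs_zero] at hge
  linarith

/-- A càdlàg function has no infinite increasing bounded sequence of jumps of size at
least `ε`. -/
lemma DInf.not_forall_jump (x : DInf) (hε : 0 < ε) {s : ℕ → ℝ≥0} (hs : StrictMono s)
    (hR : ∀ n, s n ≤ R) : ¬∀ n, ε ≤ |x.toFun (s (n + 1)) - x.toFun (s n)| := by
  intro h
  have hbdd : BddAbove (range s) := ⟨R, by rintro _ ⟨n, rfl⟩; exact hR n⟩
  have hlim := tendsto_atTop_ciSup hs.monotone hbdd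
  have hlt : ∀ n, s n < ⨆ i, s i := fun n => (hs n.lt_succ_self).trans_le (le_ciSup hbdd (n + 1))
  obtain ⟨l, hl⟩ := x.cadlag.2 (⨆ i, s i)
  have h1 : Tendsto (fun n => x.toFun (s n)) atTop (𝓝 l) :=
    hl.comp (tendsto_nhdsWithin_iff.2 ⟨hlim, Eventually.of_forall hlt⟩)
  have h2 := ((h1.comp (tendsto_add_atTop_nat 1)).sub h1).abs
  rw [sub_self, abs_zero] at h2
  exact absurd (ge_of_tendsto' h2 h) (not_le.2 hε)

lemma DInf.exists_stepApprox (x : DInf) (hε : 0 < ε)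
    (hB : ∀ s ≤ R, ∀ t ≤ R, |x.toFun t - x.toFun s| ≤ B) : ∃ N, StepApprox x R ε B N 0 := by
  by_contra! hcon
  have hB0 : 0 ≤ B := (abs_nonneg _).trans (hB 0 zero_le 0 zero_le)
  have hnext : ∀ a : {a : ℝ≥0 // a ≤ R ∧ ∀ N, ¬StepApprox x R ε B N a},
      ∃ b : {a : ℝ≥0 // a ≤ R ∧ ∀ N, ¬StepApprox x R ε B N a}, NextJump x R ε a b := by
    rintro ⟨a, ha, hN⟩
    rcases x.forall_le_or_exists_nextJump hε a R with h | ⟨b, hb⟩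
    · exact absurd (StepApprox.of_forall_le hB0 ha h) (hN 0)
    · exact ⟨⟨b, hb.2.1, fun N h => hN (N + 1) (h.cons hB hb)⟩, hb⟩
  choose g hg using hnext
  let s : ℕ → {a : ℝ≥0 // a ≤ R ∧ ∀ N, ¬StepApprox x R ε B N a} := fun n =>
    g^[n] ⟨0, zero_le, hcon⟩
  have hs : ∀ n, NextJump x R ε (s n) (s (n + 1)) := fun n => by
    simp only [s, Function.iterate_succ_apply']
    exact hg _
  exact x.not_forall_jump hε (s := fun n => (s n : ℝ≥0)) (strictMono_nat_of_lt_succ fun n =>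
    (hs n).1) (fun n => (s n).2.1) fun n => (hs n).2.2.1

/-- If `N` jumps do not suffice, then there are `N + 1` successive increments of size at
least `ε`. -/
lemma DInf.exists_chain_of_not_stepApprox (x : DInf) (hε : 0 < ε)
    (hB : ∀ s ≤ R, ∀ t ≤ R, |x.toFun t - x.toFun s| ≤ B) (ha : a ≤ R)
    (h : ¬StepApprox x R ε B N a) :
    ∃ s : ℕ → ℝ≥0, s 0 = a ∧ Monotone s ∧ (∀ i, s i ≤ R) ∧
      ∀ i < N + 1, ε ≤ |x.toFun (s (i + 1)) - x.toFun (s i)| := by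
  have hB0 : 0 ≤ B := (abs_nonneg _).trans (hB 0 zero_le 0 zero_le)
  have hcons : ∀ {N : ℕ} {a b : ℝ≥0} {s : ℕ → ℝ≥0}, NextJump x R ε a b → s 0 = b → Monotone s →
      (∀ i, s i ≤ R) → (∀ i < N, ε ≤ |x.toFun (s (i + 1)) - x.toFun (s i)|) →
      ∃ s : ℕ → ℝ≥0, s 0 = a ∧ Monotone s ∧ (∀ i, s i ≤ R) ∧
        ∀ i < N + 1, ε ≤ |x.toFun (s (i + 1)) - x.toFun (s i)| := by
    intro N a b s hab hs0 hs hsR hsx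
    refine ⟨fun i => Nat.casesOn i a s, rfl, monotone_nat_of_le_succ fun i => ?_, fun i => ?_,
      fun i hi => ?_⟩
    · cases i with
      | zero => exact hab.1.le.trans_eq hs0.symm
      | succ i => exact hs i.le_succ
    · cases i with
      | zero => exact hab.1.le.trans hab.2.1
      | succ i => exact hsR i
    · cases i with
      | zero =>
        simp only [hs0]
        exact hab.2.2.1
      | succ i => exact hsx i (Nat.lt_of_succ_lt_succ hi)
  induction N generalizing a with
  | zero =>
    rcases x.forall_le_or_exists_nextJump hε a R with h' | ⟨b, hb⟩
    · exact absurd (StepApprox.of_forall_le hB0 ha h') h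
    · exact hcons hb (s := fun _ => b) rfl monotone_const (fun _ => hb.2.1) fun i hi =>
        absurd hi (Nat.not_lt_zero i)
  | succ N ih =>
    rcases x.forall_le_or_exists_nextJump hε a R with h' | ⟨b, hb⟩
    · exact absurd (StepApprox.of_forall_le hB0 ha h') h
    · obtain ⟨s, h0, h1, h2, h3⟩ := ih hb.2.1 fun h' => h (h'.cons hB hb)
      exact hcons hb h0 h1 h2 h3

/-- A long chain of large increments of `x` is detected by a small integrator of variation at
most `2`. -/
lemma DInf.exists_integrator_of_chain (x : DInf) (hε : 0 < ε) {N : ℕ} {s : ℕ → ℝ≥0}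
    (hs : Monotone s) (hsR : ∀ i, s i ≤ R)
    (hsx : ∀ i < N + 1, ε ≤ |x.toFun (s (i + 1)) - x.toFun (s i)|) :
    ∃ A : AFin (R + 1), (∀ t, |A.toFun t| ≤ 1 / (N + 1)) ∧ totalVariation A.toFun ≤ 2 ∧
      ε / 2 ≤ |stieltjesIntegral (x.restrict (R + 1)).toFun A.toVFin| := by
  have hN : (0 : ℝ) < N + 1 := by positivity
  let d : ℕ → ℝ := fun i => x.toFun (s (i + 1)) - x.toFun (s i)
  let σ : ℕ → ℝ := fun i => if 0 ≤ d i then 1 else -1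
  have hσ : ∀ i, |σ i| = 1 := fun i => by simp only [σ]; split_ifs <;> simp
  have hσd : ∀ i, σ i * d i = |d i| := fun i => by
    simp only [σ]
    split_ifs with h
    · rw [one_mul, abs_of_nonneg h]
    · rw [abs_of_neg (not_le.1 h), neg_one_mul]
  let c : Fin (N + 1) ⊕ Fin (N + 1) → ℝ :=
    Sum.elim (fun i => σ i / (N + 1)) (fun i => -(σ i / (N + 1)))
  let p : Fin (N + 1) ⊕ Fin (N + 1) → ℝ≥0 := Sum.elim (fun i => s (i + 1)) (fun i => s i)
  have hp : ∀ i, p i < R + 1 := by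
    rintro (i | i)
    · exact (hsR _).trans_lt (lt_add_one R)
    · exact (hsR _).trans_lt (lt_add_one R)
  have hsum : ∀ f : ℝ≥0 → ℝ, ∑ i, c i * f (p i) =
      ∑ i ∈ Finset.range (N + 1), σ i / (N + 1) * (f (s (i + 1)) - f (s i)) := fun f => by
    rw [Fintype.sum_sum_type, ← Finset.sum_add_distrib, Finset.sum_range]
    refine Finset.sum_congr rfl fun i _ => ?_
    simp only [c, p, Sum.elim_inl, Sum.elim_inr]
    ring
  have hlim := (x.tendsto_stieltjesIntegral_rampSum (T := R + 1) c hp).abs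
  have hgt : ε / 2 < |∑ i, c i * x.toFun (p i)| := by
    have h1 : ε ≤ ∑ i, c i * x.toFun (p i) := by
      rw [hsum]
      calc ε = ∑ i ∈ Finset.range (N + 1), ε / (N + 1) := by
            rw [Finset.sum_const, Finset.card_range, nsmul_eq_mul]
            push_cast
            field_simp
        _ ≤ _ := by
            refine Finset.sum_le_sum fun i hi => ?_
            rw [div_mul_eq_mul_div]
            gcongr
            exact (hsx i (Finset.mem_range.1 hi)).trans_eq (hσd i).symm
    linarith [le_abs_self (∑ i, c i * x.toFun (p i))]
  obtain ⟨k, hk⟩ := (hlim.eventually (lt_mem_nhds hgt)).exists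
  refine ⟨_, fun t => ?_, ?_, hk.le⟩
  · rw [rampSum_apply, hsum fun r => rampFun r k t]
    have hanti : ∀ i, rampFun (s (i + 1)) k t ≤ rampFun (s i) k t := fun i =>
      rampFun_anti k t (hs i.le_succ)
    calc |∑ i ∈ Finset.range (N + 1), σ i / (N + 1) *
            (rampFun (s (i + 1)) k t - rampFun (s i) k t)|
        ≤ ∑ i ∈ Finset.range (N + 1), 1 / ((N : ℝ) + 1) *
            (rampFun (s i) k t - rampFun (s (i + 1)) k t) := by
          refine (Finset.abs_sum_le_sum_abs _ _).trans (Finset.sum_le_sum fun i _ => ?_)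
          rw [abs_mul, abs_div, hσ, abs_of_pos hN, abs_sub_comm,
            abs_of_nonneg (sub_nonneg.2 (hanti i))]
      _ = 1 / ((N : ℝ) + 1) * (rampFun (s 0) k t - rampFun (s (N + 1)) k t) := by
          rw [← Finset.mul_sum, Finset.sum_range_sub']
      _ ≤ 1 / ((N : ℝ) + 1) := by
          refine mul_le_of_le_one_right (by positivity) ?_
          linarith [rampFun_le_one (s 0) k t, rampFun_nonneg (s (N + 1)) k t]
  · refine (totalVariation_rampSum_le c p k).trans ?_
    have hc : ∀ i, ‖c i‖ₑ = ENNReal.ofReal (1 / ((N : ℝ) + 1)) := by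
      rintro (i | i) <;>
      simp only [c, Sum.elim_inl, Sum.elim_inr, ← ofReal_norm, norm_neg, norm_div,
        Real.norm_eq_abs, hσ, abs_of_pos hN]
    simp_rw [hc]
    rw [Finset.sum_const, nsmul_eq_mul, Finset.card_univ, Fintype.card_sum, Fintype.card_fin,
      ← ENNReal.ofReal_natCast, ← ENNReal.ofReal_mul (by positivity), ← ENNReal.ofReal_ofNat]
    apply ENNReal.ofReal_le_ofReal
    push_cast
    field_simp
    norm_num

lemma StarConv.exists_uniform_stepApprox {x : ℕ → DInf} {x₀ : DInf} (h : StarConv x x₀)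
    (hε : 0 < ε) {B : ℝ} (hB : ∀ n, ∀ s ≤ R, ∀ t ≤ R, |(x n).toFun t - (x n).toFun s| ≤ B) :
    ∃ N, ∀ n, StepApprox (x n) R ε B N 0 := by
  by_contra! hcon
  have hB0 : 0 ≤ B := (abs_nonneg _).trans (hB 0 0 zero_le 0 zero_le)
  refine h.not_frequently (T := R + 1) (by positivity) (half_pos hε) ENNReal.ofNat_lt_top
    (C := 2) fun N => ?_
  rw [frequently_atTop]
  intro n₀
  choose M hM using fun n => (x n).exists_stepApprox hε (hB n)
  obtain ⟨n, hn⟩ := hcon (max N (∑ m ∈ Finset.range n₀, M m))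
  have hn₀ : n₀ ≤ n := by
    by_contra! hlt
    have h2 := Finset.single_le_sum (f := M) (fun m _ => Nat.zero_le _) (Finset.mem_range.2 hlt)
    exact hn ((hM n).mono hB0 zero_le (h2.trans (le_max_right _ _)))
  obtain ⟨s, -, hs, hsR, hsx⟩ := (x n).exists_chain_of_not_stepApprox hε (hB n) zero_le
    fun h' => hn (h'.mono hB0 zero_le (le_max_left _ _))
  exact ⟨n, hn₀, (x n).exists_integrator_of_chain hε hs hsR hsx⟩

/-- A `*`-convergent sequence is uniformly approximated by step functions with a bounded number
of jumps, of bounded size. -/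
lemma StarConv.exists_stepFun {x : ℕ → DInf} {x₀ : DInf} (h : StarConv x x₀) (R : ℝ≥0)
    (hε : 0 < ε) : ∃ (N : ℕ) (B : ℝ), ∀ n, ∃ p : Fin N → ℝ × ℝ≥0,
      (∀ i, p i ∈ Icc (-B) B ×ˢ Icc 0 R) ∧
      ∀ t ≤ R, |(x n).toFun t - stepFun (fun i => (p i).1) (fun i => (p i).2) t| ≤ ε := by
  obtain ⟨M, hM⟩ := h.exists_bound R
  have hM0 : 0 ≤ M := (abs_nonneg _).trans (hM 0 0 zero_le)
  obtain ⟨N, hN⟩ := h.exists_uniform_stepApprox (R := R) (B := M + M) hε fun n s hs t ht =>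
    (abs_sub _ _).trans (add_le_add (hM n t ht) (hM n s hs))
  refine ⟨N + 1, M + M, fun n => ?_⟩
  obtain ⟨c, τ, hc, hτ, ha⟩ := hN n
  refine ⟨Fin.cons ((x n).toFun 0, 0) fun i => (c i, τ i), fun i => ?_, fun t ht => ?_⟩
  · refine Fin.cases ?_ (fun j => ?_) i
    · have := hM n 0 zero_le
      exact ⟨abs_le.1 (by linarith : |(x n).toFun 0| ≤ M + M), le_rfl, zero_le⟩
    · exact ⟨abs_le.1 (hc j), hτ j⟩
  · simpa [stepFun, Fin.sum_univ_succ] using ha t zero_le ht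

/-- The step function `stepFun` as an element of `𝕍([0, T])`. -/
noncomputable def step {ι : Type*} [Fintype ι] (T : ℝ≥0) (c : ι → ℝ) (τ : ι → ℝ≥0) : VFin T :=
  VFin.lin c fun i => jump T (τ i)

lemma weakStarConv_step {ι : Type*} [Fintype ι] {c : ℕ → ι → ℝ} {c₀ : ι → ℝ} {τ : ℕ → ι → ℝ≥0}
    {τ₀ : ι → ℝ≥0} (hc : ∀ i, Tendsto (fun n => c n i) atTop (𝓝 (c₀ i)))
    (hτ : ∀ i, Tendsto (fun n => τ n i) atTop (𝓝 (τ₀ i))) (hT : ∀ i, τ₀ i ≠ T) :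
    WeakStarConv (fun n => step T (c n) (τ n)) (step T c₀ τ₀) := by
  intro f hf
  simp_rw [step, VFin.stieltjesIntegral_lin _ _ hf.bddMeas]
  exact tendsto_finsetSum _ fun i _ => (hc i).mul
    ((continuousAt_stieltjesIntegral_jump hf (hT i)).tendsto.comp (hτ i))

lemma tendsto_stieltjesIntegral_step {ι : Type*} [Fintype ι] {c : ℕ → ι → ℝ} {c₀ : ι → ℝ}
    {τ : ℕ → ι → ℝ≥0} {τ₀ : ι → ℝ≥0} (hc : ∀ i, Tendsto (fun n => c n i) atTop (𝓝 (c₀ i)))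
    (hτ : ∀ i, Tendsto (fun n => τ n i) atTop (𝓝 (τ₀ i))) (A : AFin T) :
    Tendsto (fun n => stieltjesIntegral (step T (c n) (τ n)).toFun A.toVFin) atTop
      (𝓝 (stieltjesIntegral (step T c₀ τ₀).toFun A.toVFin)) := by
  obtain ⟨T', hT', hne⟩ : ∃ T', T ≤ T' ∧ ∀ i, τ₀ i ≠ T' := by
    refine ⟨T + ∑ i, τ₀ i + 1, ?_, fun i => ne_of_lt ?_⟩
    · rw [add_assoc]
      exact le_self_add
    · refine lt_of_le_of_lt ?_ (lt_add_one _)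
      exact (Finset.single_le_sum (f := τ₀) (fun _ _ => zero_le) (Finset.mem_univ i)).trans
        le_add_self
  have key := weakStarConv_step hc hτ hne (fun t => A.toFun (terminal T) - A.toFun (stopAt T t))
    (continuous_const.sub (A.continuous.comp (continuous_stopAt T T')))
  simp_rw [← stieltjesIntegral_incl hT'] at key
  exact key

/-- Step approximations of a `*`-convergent sequence pass to the limit. -/
lemma StarConv.abs_sub_stepFun_le {x : ℕ → DInf} {x₀ : DInf} (h : StarConv x x₀)
    {ι : Type*} [Fintype ι] {c : ℕ → ι → ℝ} {c₀ : ι → ℝ}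
    {τ : ℕ → ι → ℝ≥0} {τ₀ : ι → ℝ≥0} (hc : ∀ i, Tendsto (fun n => c n i) atTop (𝓝 (c₀ i)))
    (hτ : ∀ i, Tendsto (fun n => τ n i) atTop (𝓝 (τ₀ i)))
    (hx : ∀ n, ∀ t ≤ R, |(x n).toFun t - stepFun (c n) (τ n) t| ≤ ε) {t : ℝ≥0} (ht : t < R) :
    |x₀.toFun t - stepFun c₀ τ₀ t| ≤ ε := by
  have hR : 0 < R := zero_le.trans_lt ht
  have hε : 0 ≤ ε := (abs_nonneg _).trans (hx 0 0 zero_le)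
  have hint : ∀ k, |stieltjesIntegral (x₀.restrict R).toFun (ramp R t k).toVFin -
      stieltjesIntegral (step R c₀ τ₀).toFun (ramp R t k).toVFin| ≤ ε := fun k => by
    have h1 := h R hR (fun _ => ramp R t k) (ramp R t k)
      ⟨fun u hu => Eventually.of_forall fun _ _ => refl_mem_uniformity hu, by
        rw [ciSup_const]
        exact (ramp R t k).finite_variation⟩
    refine le_of_tendsto' (h1.sub (tendsto_stieltjesIntegral_step hc hτ _)).abs fun n => ?_
    refine ((ramp R t k).abs_stieltjesIntegral_sub_le ((x n).bddMeas_restrict R)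
      (step R (c n) (τ n)).bddMeas (ε := ε) fun s => hx n _ s.2.2).trans ?_
    refine mul_le_of_le_one_right hε ?_
    exact ENNReal.toReal_mono ENNReal.one_ne_top (totalVariation_rampFun_le t k)
  have hlim := ((tendsto_stieltjesIntegral_ramp (x₀.bddMeas_restrict R) ht
    ((x₀.restrict R).cadlag.1 _)).sub (tendsto_stieltjesIntegral_ramp (step R c₀ τ₀).bddMeas ht
    ((step R c₀ τ₀).cadlag.1 _))).abs
  exact le_of_tendsto' hlim hint

lemma StarConv.exists_subseq_sConv {x : ℕ → DInf} {x₀ : DInf} (h : StarConv x x₀) :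
    ∃ l : ℕ → ℕ, StrictMono l ∧ ∃ T : ℕ → ℝ≥0,
      (∀ r, 0 < T r) ∧ StrictMono T ∧ Tendsto T atTop atTop ∧
        ∀ r, SConv (fun i => (x (l i)).restrict (T r)) (x₀.restrict (T r)) := by
  choose N B p hp happ using fun q : ℕ × ℕ =>
    h.exists_stepFun ((q.1 : ℝ≥0) + 1) (Nat.one_div_pos_of_nat (α := ℝ) (n := q.2))
  let I : Type := Σ q : ℕ × ℕ, Fin (N q)
  let K : Set (I → ℝ × ℝ≥0) :=
    Set.pi univ fun i => Icc (-B i.1) (B i.1) ×ˢ Icc 0 ((i.1.1 : ℝ≥0) + 1)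
  have hK : IsCompact K := isCompact_univ_pi fun i => isCompact_Icc.prod isCompact_Icc
  obtain ⟨y, -, l, hl, hy⟩ := hK.tendsto_subseq (x := fun n (i : I) => p i.1 n i.2)
    fun n i _ => hp i.1 n i.2
  have hlim : ∀ i : I, Tendsto (fun n => p i.1 (l n) i.2) atTop (𝓝 (y i)) := fun i =>
    tendsto_pi_nhds.1 hy i
  have hc : ∀ q (i : Fin (N q)), Tendsto (fun n => (p q (l n) i).1) atTop (𝓝 (y ⟨q, i⟩).1) :=
    fun q i => (continuous_fst.tendsto _).comp (hlim ⟨q, i⟩)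
  have hτ : ∀ q (i : Fin (N q)), Tendsto (fun n => (p q (l n) i).2) atTop (𝓝 (y ⟨q, i⟩).2) :=
    fun q i => (continuous_snd.tendsto _).comp (hlim ⟨q, i⟩)
  have hT : ∀ r : ℕ, ∃ T : ℝ≥0, (r : ℝ≥0) < T ∧ T < r + 1 ∧ ∀ i, (y i).2 ≠ T := fun r => by
    have hcount : (range fun i : I => ((y i).2 : ℝ)).Countable := countable_range _
    obtain ⟨t, ht, htr⟩ := (hcount.dense_compl ℝ).exists_mem_open isOpen_Ioo
      (nonempty_Ioo.2 (lt_add_one (r : ℝ)))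
    have ht0 : (0 : ℝ) ≤ t := (Nat.cast_nonneg r).trans htr.1.le
    exact ⟨⟨t, ht0⟩, htr.1, htr.2, fun i hi => ht ⟨i, congrArg NNReal.toReal hi⟩⟩
  choose T hrT hTr hTne using hT
  refine ⟨l, hl, T, fun r => zero_le.trans_lt (hrT r), strictMono_nat_of_lt_succ fun r => ?_,
    tendsto_atTop_mono (fun r => (hrT r).le) tendsto_natCast_atTop_atTop, fun r ε hε => ?_⟩
  · refine (hTr r).trans ?_
    exact_mod_cast hrT (r + 1)
  obtain ⟨m, hm⟩ := exists_nat_one_div_lt hε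
  let q : ℕ × ℕ := (r, m)
  refine ⟨fun n => step (T r) (fun i => (p q (l n) i).1) fun i => (p q (l n) i).2,
    step (T r) (fun i => (y ⟨q, i⟩).1) fun i => (y ⟨q, i⟩).2, fun n t => ?_, fun t => ?_,
    weakStarConv_step (hc q) (hτ q) fun i => hTne r _⟩
  · have ht : (⟨t, t.2.1⟩ : ℝ≥0) ≤ r + 1 := (show (⟨t, t.2.1⟩ : ℝ≥0) ≤ T r from t.2.2).trans
      (hTr r).le
    exact (happ q (l n) _ ht).trans hm.le
  · have ht : (⟨t, t.2.1⟩ : ℝ≥0) < r + 1 := lt_of_le_of_lt (b := T r) t.2.2 (hTr r)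
    exact ((h.comp hl).abs_sub_stepFun_le (hc q) (hτ q) (fun n => happ q (l n)) ht).trans hm.le

end SkorokhodS

theorem theorem5p3 (x : ℕ → SkorokhodS.DInf) (x₀ : SkorokhodS.DInf) :
    SkorokhodS.StarConv x x₀ ↔
      ∀ k : ℕ → ℕ, StrictMono k →
        ∃ l : ℕ → ℕ, StrictMono l ∧
          ∃ T : ℕ → ℝ≥0, (∀ r, 0 < T r) ∧ StrictMono T ∧ Tendsto T atTop atTop ∧
            ∀ r, SkorokhodS.SConv (fun i => (x (k (l i))).restrict (T r)) (x₀.restrict (T r)) :=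
  ⟨fun h _ hk => (h.comp hk).exists_subseq_sConv, SkorokhodS.starConv_of_subseq⟩
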